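/- Let $T$ be a finite rooted tree with vertex set $N$. A flow on $T$ is a vector $\mu\in\mathbb{R}^N$ such that $\mu_i\ge\sum_{j\in\mathcal C(i)}\mu_j$ for every vertex $i$, where $\mathcal C(i)$ is the set of children of $i$ (the sum is $0$ if $i$ is a leaf); let $\mathcal F(T)$ denote the set of flows, a closed convex cone. For $\mu\in\mathcal F(T)$ one observes $Y_i=\mu_i+\epsilon_i$, $i\in N$, with independent errors $\epsilon_i\sim N(0,\sigma^2)$, and the least squares estimator $\hat\mu$ is the unique minimizer of $\sum_{i\in N}(Y_i-f_i)^2$ over $f\in\mathcal F(T)$. For an integer $n\ge1$ and $0\le\alpha\le1$, let $\mathcal T_{\alpha,n}$ be the tree consisting of a root with $\lceil n^\alpha\rceil$ children, each of which is the starting point of a path of $\lceil n^{1-\alpha}\rceil$ vertices (so the number of vertices lies between $n+1$ and $5n$). **Theorem.** There is a universal constant $C>0$ such that for all integers $n\ge1$, all $\alpha\in[0,1]$, all $\sigma\ge0$, all $V\in\mathbb{R}$, and every flow $\mu\in\mathcal F(\mathcal T_{\alpha,n})$ whose value at the root is at most $V$, the random variable $\|\hat\mu-\mu\|^2$ (squared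 Euclidean norm) is integrable and $$\mathbb E\,\frac1n\|\hat\mu-\mu\|^2\;\le\;C\left(\frac{\sigma^2(\log(en))^3}{n^\alpha}+V\,\frac{\sigma(\log(en))^{3/2}}{n^\alpha}\right).$$ -/

import Mathlib

open MeasureTheory ProbabilityTheory
open scoped NNReal

noncomputable section

namespace TreeFlow

/-- A rooted tree on the vertex set `N`, given by its parent map. The root is (by convention) its
own parent, and every vertex is joined to the root by iterating the parent map. -/
structure Tree (N : Type*) where
  root : N
  parent : N → N
  parent_root : parent root = root
  reaches_root : ∀ v, ∃ k : ℕ, parent^[k] v = root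

section General

variable {N : Type*} [Fintype N]

open Classical in
/-- The children of the vertex `i`. -/
def Tree.children (T : Tree N) (i : N) : Finset N :=
  Finset.univ.filter fun j => j ≠ T.root ∧ T.parent j = i

/-- The cone of flows on `T`: the flow into each vertex is at least the total flow into its
children. At a leaf the sum is empty, so the condition says that the flow is nonnegative. -/
def Tree.flows (T : Tree N) : Set (N → ℝ) :=
  {f | ∀ i, ∑ j ∈ T.children i, f j ≤ f i}

/-- `f` is a least squares fit to the data `y` among the flows on `T`. -/
def Tree.IsLSE (T : Tree N) (y f : N → ℝ) : Prop :=
  f ∈ T.flows ∧ ∀ g ∈ T.flows, ∑ i, (y i - f i) ^ 2 ≤ ∑ i, (y i - g i) ^ 2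

theorem Tree.exists_isLSE (T : Tree N) (y : N → ℝ) : ∃ f, T.IsLSE y f := by
  have hcl : IsClosed {f : EuclideanSpace ℝ N | (fun i => f i) ∈ T.flows} := by
    have h : {f : EuclideanSpace ℝ N | (fun i => f i) ∈ T.flows}
        = ⋂ i, {f : EuclideanSpace ℝ N | ∑ j ∈ T.children i, f j ≤ f i} := by
      ext f; simp [Tree.flows]
    rw [h]
    exact isClosed_iInter fun i => isClosed_le (by fun_prop) (by fun_prop)
  have hne : {f : EuclideanSpace ℝ N | (fun i => f i) ∈ T.flows}.Nonempty :=
    ⟨0, by simp [Tree.flows]⟩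
  obtain ⟨f, hf, hd⟩ := hcl.exists_infDist_eq_dist hne (WithLp.toLp 2 y)
  refine ⟨fun i => f i, hf, fun g hg => ?_⟩
  have h1 : dist (WithLp.toLp 2 y) f ≤ dist (WithLp.toLp 2 y) (WithLp.toLp 2 g) := by
    rw [← hd]
    exact Metric.infDist_le_dist_of_mem hg
  rw [EuclideanSpace.dist_eq, EuclideanSpace.dist_eq,
    Real.sqrt_le_sqrt_iff (Finset.sum_nonneg fun i _ => sq_nonneg _)] at h1
  simpa [Real.dist_eq, sq_abs] using h1

theorem Tree.IsLSE.unique {T : Tree N} {y f g : N → ℝ} (hf : T.IsLSE y f) (hg : T.IsLSE y g) :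
    f = g := by
  have hmid : (fun i => (f i + g i) / 2) ∈ T.flows := by
    intro i
    have h1 := hf.1 i
    have h2 := hg.1 i
    rw [← Finset.sum_div, Finset.sum_add_distrib]
    linarith
  have h1 := hf.2 _ hmid
  have h2 := hg.2 _ hmid
  have h3 : ∑ i, (f i - g i) ^ 2 = 2 * ∑ i, (y i - f i) ^ 2 + 2 * ∑ i, (y i - g i) ^ 2
      - 4 * ∑ i, (y i - (f i + g i) / 2) ^ 2 := by
    simp only [Finset.mul_sum, ← Finset.sum_add_distrib, ← Finset.sum_sub_distrib]
    exact Finset.sum_congr rfl fun i _ => by ring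
  have h4 : ∑ i, (f i - g i) ^ 2 = 0 :=
    le_antisymm (by linarith) (Finset.sum_nonneg fun i _ => sq_nonneg _)
  rw [Finset.sum_eq_zero_iff_of_nonneg fun i _ => sq_nonneg _] at h4
  funext i
  have h5 := h4 i (Finset.mem_univ i)
  have h6 : f i - g i = 0 := by simpa using h5
  linarith

/-- The least squares estimator: the unique least squares fit to `y` among the flows on `T`. -/
def Tree.lse (T : Tree N) (y : N → ℝ) : N → ℝ := Classical.choose (T.exists_isLSE y)

theorem Tree.isLSE_lse (T : Tree N) (y : N → ℝ) : T.IsLSE y (T.lse y) :=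
  Classical.choose_spec (T.exists_isLSE y)

/-- The law of the observation `Y = μ + ε`, where the `ε i` are independent `N(0, σ²)`. -/
def obsLaw (μ : N → ℝ) (σ : ℝ≥0) : Measure (N → ℝ) :=
  Measure.pi fun i => gaussianReal (μ i) (σ ^ 2)

end General

/-- The parent map of the tree consisting of a root `none` with `m` paths of `l` vertices attached
to it; `some (j, k)` is the vertex in position `k` (counted from `0`) of the `j`-th path. -/
def kiteParent (m l : ℕ) : Option (Fin m × Fin l) → Option (Fin m × Fin l)
  | none => none
  | some (_, ⟨0, _⟩) => none
  | some (j, ⟨k + 1, h⟩) => some (j, ⟨k, Nat.lt_of_succ_lt h⟩)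

theorem kiteParent_iterate (m l : ℕ) (j : Fin m) (k : ℕ) (hk : k < l) :
    (kiteParent m l)^[k + 1] (some (j, ⟨k, hk⟩)) = none := by
  induction k with
  | zero => rfl
  | succ k ih =>
    rw [Function.iterate_succ_apply]
    exact ih (Nat.lt_of_succ_lt hk)

/-- The tree consisting of a root with `m` children, each of which starts a path of `l` vertices. -/
def kite (m l : ℕ) : Tree (Option (Fin m × Fin l)) where
  root := none
  parent := kiteParent m l
  parent_root := rfl
  reaches_root
    | none => ⟨0, rfl⟩
    | some (j, ⟨k, hk⟩) => ⟨k + 1, kiteParent_iterate m l j k hk⟩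

/-- The number `⌈n ^ α⌉` of paths of the tree with parameters `α` and `n`. -/
def numPaths (α : ℝ) (n : ℕ) : ℕ := ⌈(n : ℝ) ^ α⌉₊

/-- The length `⌈n ^ (1 - α)⌉` of the paths of the tree with parameters `α` and `n`. -/
def pathLength (α : ℝ) (n : ℕ) : ℕ := ⌈(n : ℝ) ^ (1 - α)⌉₊

/-- The vertices of the tree with parameters `α` and `n`. -/
abbrev DeepNode (α : ℝ) (n : ℕ) : Type := Option (Fin (numPaths α n) × Fin (pathLength α n))

/-- The tree with parameters `α` and `n`: a root with `⌈n ^ α⌉` children, each starting a path of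
`⌈n ^ (1 - α)⌉` vertices. -/
def deepTree (α : ℝ) (n : ℕ) : Tree (DeepNode α n) := kite (numPaths α n) (pathLength α n)

end TreeFlow

end

/-!
The least squares estimator is the projection of the data `y = μ + σ z` on a convex set containing
`μ`, so its error `Δ` satisfies `‖Δ‖² ≤ σ ⟨z, Δ⟩` (`Tree.IsLSE.sum_sq_sub_le`). Along each path a flow
is nonnegative and nonincreasing, and its values at the beginnings of the paths add up to at most its
value at the root. Summation by parts therefore bounds the pairing of `z` with the path part of a flow
`f` by `W * f none`, where `W` is the largest absolute value of a partial sum of `z` along a path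
(`abs_sum_mul_flow_le`). Applying this to the estimator and to `μ`, and taking `W` at least the noise
at the root, `‖Δ‖² ≤ 2 σ W (|Δ none| + μ none)`; since `|Δ none| ≤ ‖Δ‖`, this gives
`‖Δ‖² ≤ 4 σ² W² + 4 σ W μ none` (`loss_le_softMaxSq`).

On paths of length `l` the partial sums are centred Gaussian variables of variance at most `l`, and
there are at most about `4 n` of them, so comparison of their maximum with a sum of exponentials
(`integral_softMaxSq_le`) bounds the mean of `W²` by a multiple of `l * (log (e n))²`. The result is a
risk of order `σ² l (log (e n))² + σ V √l log (e n)`, which is smaller than what is claimed because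
`√l ≤ l` and `l / n ≤ 2 / n ^ α`. Integrability follows from the same pointwise bound, as the
estimator is a continuous function of the data (`Tree.continuous_lse`).
-/

open MeasureTheory ProbabilityTheory
open scoped NNReal

noncomputable section

namespace TreeFlow

/-! ### The projection on the cone of flows -/

section Projection

variable {N : Type*} [Fintype N]

/-- The variational inequality for the projection on a convex set. -/
theorem Tree.IsLSE.sum_mul_sub_nonpos {T : Tree N} {y f g : N → ℝ} (hf : T.IsLSE y f)
    (hg : g ∈ T.flows) : ∑ i, (y i - f i) * (g i - f i) ≤ 0 := by
  by_contra! ha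
  set a := ∑ i, (y i - f i) * (g i - f i) with ha'
  set b := ∑ i, (g i - f i) ^ 2 with hb'
  have hb : 0 ≤ b := Finset.sum_nonneg fun i _ => sq_nonneg _
  -- a step size `t ∈ (0, 1)` towards `g` with `t * b < a`
  set t := a / (a + b + 1) with ht'
  have hab : 0 < a + b + 1 := by linarith
  have ht : 0 < t := div_pos ha hab
  have ht1 : t ≤ 1 := (div_le_one hab).2 (by linarith)
  have htb : t * b ≤ a := by
    rw [ht', div_mul_eq_mul_div, div_le_iff₀ hab]
    nlinarith
  have hmem : (fun i => (1 - t) * f i + t * g i) ∈ T.flows := by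
    intro i
    have h1 := mul_le_mul_of_nonneg_left (hf.1 i) (sub_nonneg.2 ht1)
    have h2 := mul_le_mul_of_nonneg_left (hg i) ht.le
    rw [Finset.sum_add_distrib, ← Finset.mul_sum, ← Finset.mul_sum]
    exact add_le_add h1 h2
  have h := hf.2 _ hmem
  have hexp : ∑ i, (y i - ((1 - t) * f i + t * g i)) ^ 2
      = ∑ i, (y i - f i) ^ 2 - 2 * t * a + t * (t * b) := by
    simp only [ha', hb', Finset.mul_sum, ← Finset.sum_add_distrib, ← Finset.sum_sub_distrib]
    exact Finset.sum_congr rfl fun i _ => by ring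
  rw [hexp] at h
  nlinarith

theorem Tree.IsLSE.sum_sq_sub_le {T : Tree N} {y μ f : N → ℝ} (hf : T.IsLSE y f)
    (hμ : μ ∈ T.flows) :
    ∑ i, (f i - μ i) ^ 2 ≤ ∑ i, (y i - μ i) * (f i - μ i) := by
  have h := hf.sum_mul_sub_nonpos hμ
  have e : ∑ i, (f i - μ i) ^ 2
      = ∑ i, (y i - μ i) * (f i - μ i) + ∑ i, (y i - f i) * (μ i - f i) := by
    simp only [← Finset.sum_add_distrib]
    exact Finset.sum_congr rfl fun i _ => by ring
  linarith

/-- The least squares fit is a nonexpansive function of the data. -/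
theorem Tree.IsLSE.sum_sq_sub_le_sum_sq_sub {T : Tree N} {y y' f f' : N → ℝ} (hf : T.IsLSE y f)
    (hf' : T.IsLSE y' f') : ∑ i, (f i - f' i) ^ 2 ≤ ∑ i, (y i - y' i) ^ 2 := by
  have h := hf.sum_mul_sub_nonpos hf'.1
  have h' := hf'.sum_mul_sub_nonpos hf.1
  have e : ∑ i, ((f i - f' i) ^ 2 + (y i - y' i - (f i - f' i)) ^ 2)
      = ∑ i, (y i - y' i) ^ 2 + 2 * ∑ i, (y i - f i) * (f' i - f i)
        + 2 * ∑ i, (y' i - f' i) * (f i - f' i) := by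
    simp only [Finset.mul_sum, ← Finset.sum_add_distrib]
    exact Finset.sum_congr rfl fun i _ => by ring
  rw [Finset.sum_add_distrib] at e
  have h0 : 0 ≤ ∑ i, (y i - y' i - (f i - f' i)) ^ 2 := Finset.sum_nonneg fun i _ => sq_nonneg _
  linarith

theorem Tree.continuous_lse (T : Tree N) : Continuous T.lse := by
  refine continuous_pi fun i => continuous_iff_continuousAt.2 fun y => ?_
  rw [ContinuousAt, tendsto_iff_norm_sub_tendsto_zero]
  have hlim : Filter.Tendsto (fun y' : N → ℝ => √(∑ i, (y' i - y i) ^ 2)) (nhds y) (nhds 0) := by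
    have hc : Continuous fun y' : N → ℝ => √(∑ i, (y' i - y i) ^ 2) := by fun_prop
    simpa using hc.tendsto y
  refine squeeze_zero (fun _ => norm_nonneg _) (fun y' => ?_) hlim
  rw [Real.norm_eq_abs]
  refine Real.abs_le_sqrt (le_trans ?_
    ((T.isLSE_lse y').sum_sq_sub_le_sum_sq_sub (T.isLSE_lse y)))
  exact Finset.single_le_sum (f := fun i => (T.lse y' i - T.lse y i) ^ 2)
    (fun i _ => sq_nonneg _) (Finset.mem_univ i)

end Projection

/-! ### Maxima of Gaussian linear forms -/

section Gaussian

variable {N ι : Type*} [Fintype N] [Fintype ι]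

/-- The standard Gaussian measure on `N → ℝ`. -/
def stdNoise (N : Type*) [Fintype N] : Measure (N → ℝ) := Measure.pi fun _ => gaussianReal 0 1

instance : IsProbabilityMeasure (stdNoise N) := by unfold stdNoise; infer_instance

theorem obsLaw_eq_map_stdNoise (μ : N → ℝ) (σ : ℝ≥0) :
    obsLaw μ σ = (stdNoise N).map fun z i => μ i + σ * z i := by
  unfold obsLaw stdNoise
  have h (i : N) : (gaussianReal 0 1).map (fun x => μ i + σ * x)
      = gaussianReal (μ i) (σ ^ 2) := by
    have e : (fun x : ℝ => μ i + σ * x) = (μ i + ·) ∘ (σ * · : ℝ → ℝ) := rfl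
    rw [e, ← Measure.map_map (by fun_prop) (by fun_prop), gaussianReal_map_const_mul,
      gaussianReal_map_const_add]
    congr 1
    · simp
    · ext; simp
  rw [Measure.pi_map_pi (f := fun i x => μ i + σ * x) fun i => by fun_prop]
  simp_rw [h]

theorem integrable_exp_sum_stdNoise (a : N → ℝ) :
    Integrable (fun z => Real.exp (∑ i, a i * z i)) (stdNoise N) := by
  simp_rw [Real.exp_sum]
  exact Integrable.fintype_prod (f := fun i x => Real.exp (a i * x))
    fun i => integrable_exp_mul_gaussianReal (a i)

theorem integral_exp_sum_stdNoise (a : N → ℝ) :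
    ∫ z, Real.exp (∑ i, a i * z i) ∂stdNoise N = Real.exp ((∑ i, a i ^ 2) / 2) := by
  simp_rw [Real.exp_sum]
  have h := integral_fintype_prod_eq_prod (μ := fun _ : N => gaussianReal 0 1)
    (f := fun i x => Real.exp (a i * x))
  unfold stdNoise
  rw [h, Finset.sum_div, Real.exp_sum]
  refine Finset.prod_congr rfl fun i _ => ?_
  have := congrFun (mgf_id_gaussianReal (μ := 0) (v := 1)) (a i)
  simpa [mgf] using this

/-- A smooth bound for the largest square of the linear forms `z ↦ ∑ v, A i v * z v`: the maximum
is replaced by a sum of exponentials, and `c` plays the role of its logarithmic size. -/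
def softMaxSq (A : ι → N → ℝ) (c : ℝ) (z : N → ℝ) : ℝ :=
  2 * c ^ 2 + 4 * Real.exp (-c) *
    ∑ i, (Real.exp (∑ v, A i v * z v) + Real.exp (∑ v, -A i v * z v))

theorem sq_le_two_mul_sq_add_exp {c x : ℝ} (hx : 0 ≤ x) :
    x ^ 2 ≤ 2 * c ^ 2 + 4 * (Real.exp (-c) * Real.exp x) := by
  rw [← Real.exp_add]
  rcases le_total x c with h | h
  · have := Real.exp_pos (-c + x)
    nlinarith
  · have := Real.quadratic_le_exp_of_nonneg (x := -c + x) (by linarith)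
    nlinarith [sq_nonneg (x - 2 * c)]

theorem softMaxSq_nonneg (A : ι → N → ℝ) (c : ℝ) (z : N → ℝ) : 0 ≤ softMaxSq A c z := by
  unfold softMaxSq; positivity

theorem sq_le_softMaxSq (A : ι → N → ℝ) {c : ℝ} (z : N → ℝ) (i : ι) :
    (∑ v, A i v * z v) ^ 2 ≤ softMaxSq A c z := by
  set x := ∑ v, A i v * z v with hx
  have hneg : ∑ v, -A i v * z v = -x := by simp [hx]
  have h1 : Real.exp |x| ≤ Real.exp (∑ v, A i v * z v) + Real.exp (∑ v, -A i v * z v) := by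
    rw [hneg, ← hx]
    exact Real.exp_abs_le x
  have h2 : Real.exp |x| ≤ ∑ i, (Real.exp (∑ v, A i v * z v) + Real.exp (∑ v, -A i v * z v)) :=
    h1.trans (Finset.single_le_sum
      (f := fun i => Real.exp (∑ v, A i v * z v) + Real.exp (∑ v, -A i v * z v))
      (fun i _ => by positivity) (Finset.mem_univ i))
  have h3 := sq_le_two_mul_sq_add_exp (c := c) (abs_nonneg x)
  have h4 := mul_le_mul_of_nonneg_left h2 (Real.exp_pos (-c)).le
  rw [sq_abs] at h3
  unfold softMaxSq
  linarith

theorem integrable_softMaxSq (A : ι → N → ℝ) (c : ℝ) :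
    Integrable (softMaxSq A c) (stdNoise N) := by
  unfold softMaxSq
  refine (integrable_const _).add (Integrable.const_mul (integrable_finsetSum _ fun i _ => ?_) _)
  exact (integrable_exp_sum_stdNoise (A i)).add (integrable_exp_sum_stdNoise fun v => -A i v)

/-- For linear forms of variance at most `1`, the mean of `softMaxSq` is of order `c ^ 2` as soon as
`c` is at least the logarithm of their number. -/
theorem integral_softMaxSq_le {A : ι → N → ℝ} {c : ℝ} (hA : ∀ i, ∑ v, A i v ^ 2 ≤ 1)
    (hc : Fintype.card ι ≤ Real.exp c) :
    ∫ z, softMaxSq A c z ∂stdNoise N ≤ 2 * c ^ 2 + 16 := by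
  have hI (i : ι) : Integrable (fun z => Real.exp (∑ v, A i v * z v)
      + Real.exp (∑ v, -A i v * z v)) (stdNoise N) :=
    (integrable_exp_sum_stdNoise (A i)).add (integrable_exp_sum_stdNoise fun v => -A i v)
  have hexp : Real.exp (1 / 2) ≤ 2 := by
    have h1 := Real.exp_one_lt_d9
    have h2 : Real.exp (1 / 2) * Real.exp (1 / 2) = Real.exp 1 := by
      rw [← Real.exp_add]; norm_num
    nlinarith [Real.exp_pos (1 / 2)]
  have hi (i : ι) : ∫ z, (Real.exp (∑ v, A i v * z v)
      + Real.exp (∑ v, -A i v * z v)) ∂stdNoise N ≤ 4 := by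
    rw [integral_add (integrable_exp_sum_stdNoise (A i))
      (integrable_exp_sum_stdNoise fun v => -A i v), integral_exp_sum_stdNoise,
      integral_exp_sum_stdNoise fun v => -A i v]
    simp only [neg_sq]
    have : Real.exp ((∑ v, A i v ^ 2) / 2) ≤ Real.exp (1 / 2) :=
      Real.exp_le_exp.2 (by linarith [hA i])
    linarith
  have hsum : ∑ i, ∫ z, (Real.exp (∑ v, A i v * z v)
      + Real.exp (∑ v, -A i v * z v)) ∂stdNoise N ≤ Fintype.card ι * 4 := by
    simpa using Finset.sum_le_card_nsmul Finset.univ _ 4 fun i _ => hi i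
  unfold softMaxSq
  rw [integral_add (integrable_const _)
      (Integrable.const_mul (integrable_finsetSum _ fun i _ => hI i) _),
    integral_const_mul (4 * Real.exp (-c)), integral_finsetSum _ fun i _ => hI i]
  simp only [integral_const, probReal_univ, one_smul]
  have h1 : Real.exp (-c) * Real.exp c = 1 := by rw [← Real.exp_add]; simp
  have h2 := mul_le_mul_of_nonneg_left (hsum.trans (mul_le_mul_of_nonneg_right hc zero_le_four))
    (Real.exp_pos (-c)).le
  nlinarith

end Gaussian

/-! ### Flows on paths attached to a root -/

section Paths

/-- Summation by parts: pairing with a nonincreasing nonnegative sequence costs at most its initial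
value times a bound for the partial sums. -/
theorem abs_sum_mul_le_of_antitone {g x : ℕ → ℝ} (hg : Antitone g) (hg0 : ∀ k, 0 ≤ g k) {W : ℝ}
    (hW : 0 ≤ W) (l : ℕ) (hx : ∀ k < l, |∑ i ∈ Finset.range (k + 1), x i| ≤ W) :
    |∑ k ∈ Finset.range l, x k * g k| ≤ W * g 0 := by
  -- up to the boundary term, the first `p` summands cost at most the total decrease of `g` so far
  have key : ∀ p ≤ l, |∑ k ∈ Finset.range p, x k * g k - (∑ k ∈ Finset.range p, x k) * g p|
      ≤ W * (g 0 - g p) := by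
    intro p
    induction p with
    | zero => simp
    | succ p ih =>
      intro hp
      have h1 := ih (by omega)
      have h2 := hx p hp
      have h3 : 0 ≤ g p - g (p + 1) := sub_nonneg.2 (hg p.le_succ)
      have e : ∑ k ∈ Finset.range (p + 1), x k * g k
            - (∑ k ∈ Finset.range (p + 1), x k) * g (p + 1)
          = (∑ k ∈ Finset.range p, x k * g k - (∑ k ∈ Finset.range p, x k) * g p)
            + (∑ k ∈ Finset.range (p + 1), x k) * (g p - g (p + 1)) := by
        simp only [Finset.sum_range_succ]; ring
      rw [e]
      refine (abs_add_le _ _).trans ?_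
      rw [abs_mul, abs_of_nonneg h3]
      nlinarith [mul_le_mul_of_nonneg_right h2 h3]
  have hl : |(∑ k ∈ Finset.range l, x k) * g l| ≤ W * g l := by
    rw [abs_mul, abs_of_nonneg (hg0 l)]
    refine mul_le_mul_of_nonneg_right ?_ (hg0 l)
    cases l with
    | zero => simpa using hW
    | succ k => exact hx k k.lt_succ_self
  have h := key l le_rfl
  rw [abs_le] at h hl ⊢
  constructor <;> linarith [h.1, h.2, hl.1, hl.2]

theorem Tree.mem_children {N : Type*} [Fintype N] (T : Tree N) (i j : N) :
    j ∈ T.children i ↔ j ≠ T.root ∧ T.parent j = i := by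
  simp [Tree.children]

variable {m l : ℕ}

theorem mem_children_kite_none (hl : 0 < l) (v : Option (Fin m × Fin l)) :
    v ∈ (kite m l).children none ↔ ∃ j, some (j, ⟨0, hl⟩) = v := by
  rw [Tree.mem_children]
  rcases v with _ | ⟨j, k, hk⟩
  · simp [kite]
  · rcases k with _ | k <;> simp [kite, kiteParent]

theorem mem_children_kite_some (j : Fin m) (k : ℕ) (hk : k < l) (v : Option (Fin m × Fin l)) :
    v ∈ (kite m l).children (some (j, ⟨k, hk⟩)) ↔
      ∃ h : k + 1 < l, v = some (j, ⟨k + 1, h⟩) := by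
  rw [Tree.mem_children]
  rcases v with _ | ⟨i, p, hp⟩
  · simp [kite]
  · rcases p with _ | p
    · simp [kite, kiteParent]
    · simp only [kite, kiteParent, ne_eq, reduceCtorEq, not_false_eq_true, true_and,
        Option.some.injEq, Prod.mk.injEq, Fin.mk.injEq, add_left_inj]
      constructor
      · rintro ⟨rfl, rfl⟩
        exact ⟨hp, rfl, rfl⟩
      · rintro ⟨-, rfl, rfl⟩
        exact ⟨rfl, rfl⟩

/-- The values of `f` along the `j`-th path, continued by `0`. -/
def pathSeq (f : Option (Fin m × Fin l) → ℝ) (j : Fin m) (k : ℕ) : ℝ :=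
  if h : k < l then f (some (j, ⟨k, h⟩)) else 0

theorem antitone_pathSeq {f : Option (Fin m × Fin l) → ℝ} (hf : f ∈ (kite m l).flows)
    (j : Fin m) : Antitone (pathSeq f j) := by
  refine antitone_nat_of_succ_le fun k => ?_
  by_cases hk : k < l
  · have h := hf (some (j, ⟨k, hk⟩))
    by_cases hk1 : k + 1 < l
    · have e : (kite m l).children (some (j, ⟨k, hk⟩)) = {some (j, ⟨k + 1, hk1⟩)} := by
        ext v
        simp [mem_children_kite_some, hk1]
      rw [e, Finset.sum_singleton] at h
      simpa [pathSeq, hk, hk1] using h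
    · have e : (kite m l).children (some (j, ⟨k, hk⟩)) = ∅ := by
        ext v
        simp [mem_children_kite_some, hk1]
      rw [e, Finset.sum_empty] at h
      simpa [pathSeq, hk, hk1] using h
  · have hk1 : ¬ k + 1 < l := by omega
    simp [pathSeq, hk, hk1]

theorem pathSeq_nonneg {f : Option (Fin m × Fin l) → ℝ} (hf : f ∈ (kite m l).flows)
    (j : Fin m) (k : ℕ) : 0 ≤ pathSeq f j k := by
  have h := antitone_pathSeq hf j (le_max_left k l)
  simpa [pathSeq] using h

theorem sum_pathSeq_zero_le {f : Option (Fin m × Fin l) → ℝ} (hl : 0 < l)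
    (hf : f ∈ (kite m l).flows) : ∑ j, pathSeq f j 0 ≤ f none := by
  classical
  have e : (kite m l).children none = Finset.univ.image fun j => some (j, ⟨0, hl⟩) := by
    ext v
    simp [mem_children_kite_none hl]
  have h := hf none
  rw [e, Finset.sum_image (by intro a _ b _ hab; simpa using hab)] at h
  simpa [pathSeq, hl] using h

theorem root_nonneg {f : Option (Fin m × Fin l) → ℝ} (hl : 0 < l)
    (hf : f ∈ (kite m l).flows) : 0 ≤ f none :=
  (Finset.sum_nonneg fun j _ => pathSeq_nonneg hf j 0).trans (sum_pathSeq_zero_le hl hf)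

/-- A flow that is `s` at the root is controlled on the paths like a point of an `ℓ¹`-ball of radius
`s`: its pairing with `z` is at most `s` times the largest partial sum of `z` along a path. -/
theorem abs_sum_mul_flow_le (hl : 0 < l) {f z : Option (Fin m × Fin l) → ℝ}
    (hf : f ∈ (kite m l).flows) {W : ℝ} (hW : 0 ≤ W)
    (hz : ∀ j, ∀ k < l, |∑ i ∈ Finset.range (k + 1), pathSeq z j i| ≤ W) :
    |∑ p : Fin m × Fin l, z (some p) * f (some p)| ≤ W * f none := by
  have e : ∑ p : Fin m × Fin l, z (some p) * f (some p)
      = ∑ j, ∑ k ∈ Finset.range l, pathSeq z j k * pathSeq f j k := by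
    rw [Fintype.sum_prod_type]
    refine Finset.sum_congr rfl fun j _ => ?_
    rw [← Fin.sum_univ_eq_sum_range]
    exact Finset.sum_congr rfl fun k _ => by simp [pathSeq]
  rw [e]
  refine (Finset.abs_sum_le_sum_abs _ _).trans ?_
  refine (Finset.sum_le_sum fun j _ => abs_sum_mul_le_of_antitone (antitone_pathSeq hf j)
    (pathSeq_nonneg hf j) hW l (hz j)).trans ?_
  rw [← Finset.mul_sum]
  exact mul_le_mul_of_nonneg_left (sum_pathSeq_zero_le hl hf) hW

/-- The coefficients of the normalized linear forms in the noise: at the root, the noise there; at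
position `k` of the `j`-th path, the sum of the noise up to position `k`, divided by `√l`. -/
def pathCoeff (m l : ℕ) : Option (Fin m × Fin l) → Option (Fin m × Fin l) → ℝ
  | none, none => 1
  | some (j, k), some (i, p) => if i = j ∧ p ≤ k then 1 / √l else 0
  | _, _ => 0

theorem sum_pathCoeff_none_mul (z : Option (Fin m × Fin l) → ℝ) :
    ∑ v, pathCoeff m l none v * z v = z none := by
  simp [Fintype.sum_option, pathCoeff]

theorem sum_pathCoeff_some_mul (z : Option (Fin m × Fin l) → ℝ) (j : Fin m) (k : ℕ) (hk : k < l) :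
    ∑ v, pathCoeff m l (some (j, ⟨k, hk⟩)) v * z v
      = 1 / √l * ∑ i ∈ Finset.range (k + 1), pathSeq z j i := by
  have e : ∑ i ∈ Finset.range (k + 1), pathSeq z j i
      = ∑ i ∈ Finset.range l, if i ≤ k then pathSeq z j i else 0 := by
    rw [← Finset.sum_filter]
    congr 1
    ext i
    simp only [Finset.mem_range, Finset.mem_filter]
    omega
  rw [e, ← Fin.sum_univ_eq_sum_range fun i => if i ≤ k then pathSeq z j i else 0,
    Fintype.sum_option, Fintype.sum_prod_type, Finset.sum_eq_single j]
  · rw [Finset.mul_sum]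
    simp [pathCoeff, pathSeq, Fin.le_def]
  · intro i _ hi
    simp [pathCoeff, hi]
  · simp

theorem sum_sq_pathCoeff_le (i : Option (Fin m × Fin l)) : ∑ v, pathCoeff m l i v ^ 2 ≤ 1 := by
  rcases i with _ | ⟨j, k⟩
  · simp [Fintype.sum_option, pathCoeff]
  · have hl : (0 : ℝ) < l := by exact_mod_cast k.pos
    rw [Fintype.sum_option, Fintype.sum_prod_type, Finset.sum_eq_single j]
    · have h : ∀ p ∈ (Finset.univ : Finset (Fin l)),
          pathCoeff m l (some (j, k)) (some (j, p)) ^ 2 ≤ 1 / l := by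
        intro p _
        by_cases hp : p ≤ k
        · simp [pathCoeff, hp, Real.sq_sqrt hl.le]
        · simp [pathCoeff, hp]
      have h1 := Finset.sum_le_card_nsmul _ _ _ h
      have h2 : (l : ℝ) * (1 / l) = 1 := by field_simp
      simp only [Finset.card_univ, Fintype.card_fin, nsmul_eq_mul, h2] at h1
      simpa [pathCoeff] using h1
    · intro i _ hi
      simp [pathCoeff, hi]
    · simp

/-- The deterministic bound: the loss is controlled by the noise at the root and by its partial
sums along the paths. -/
theorem loss_le_softMaxSq (hl : 0 < l) {μ : Option (Fin m × Fin l) → ℝ}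
    (hμ : μ ∈ (kite m l).flows) (σ : ℝ≥0) (c : ℝ) (z : Option (Fin m × Fin l) → ℝ) :
    ∑ i, ((kite m l).lse (fun i => μ i + σ * z i) i - μ i) ^ 2
      ≤ 4 * σ ^ 2 * l * softMaxSq (pathCoeff m l) c z
        + 4 * σ * μ none * (√l * √(softMaxSq (pathCoeff m l) c z)) := by
  set B := softMaxSq (pathCoeff m l) c z with hB
  have hB0 : 0 ≤ B := softMaxSq_nonneg _ _ _
  have hlR : (1 : ℝ) ≤ l := by exact_mod_cast hl
  have hs1 : 1 ≤ √(l : ℝ) := Real.one_le_sqrt.2 hlR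
  have hs2 : √(l : ℝ) ^ 2 = l := Real.sq_sqrt (by linarith)
  have hb2 : √B ^ 2 = B := Real.sq_sqrt hB0
  have hb0 : 0 ≤ √B := Real.sqrt_nonneg _
  set W := √(l : ℝ) * √B with hW
  have hW0 : 0 ≤ W := by positivity
  have hσ : (0 : ℝ) ≤ σ := σ.2
  have hz0 : |z none| ≤ W := by
    have h := Real.abs_le_sqrt (sq_le_softMaxSq (pathCoeff m l) (c := c) z none)
    rw [sum_pathCoeff_none_mul] at h
    exact h.trans (le_mul_of_one_le_left hb0 hs1)
  have hz : ∀ j, ∀ k < l, |∑ i ∈ Finset.range (k + 1), pathSeq z j i| ≤ W := by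
    intro j k hk
    have h := Real.abs_le_sqrt (sq_le_softMaxSq (pathCoeff m l) (c := c) z (some (j, ⟨k, hk⟩)))
    rw [sum_pathCoeff_some_mul, abs_mul, abs_of_nonneg (by positivity), one_div,
      inv_mul_le_iff₀ (by linarith)] at h
    exact h
  set y : Option (Fin m × Fin l) → ℝ := fun i => μ i + σ * z i with hy
  have hlse := (kite m l).isLSE_lse y
  set f := (kite m l).lse y with hf
  have h1 := hlse.sum_sq_sub_le hμ
  have hf1 := (abs_le.1 (abs_sum_mul_flow_le hl hlse.1 hW0 hz)).2
  have hμ1 := (abs_le.1 (abs_sum_mul_flow_le hl hμ hW0 hz)).1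
  have e : ∑ i, (y i - μ i) * (f i - μ i)
      = σ * (z none * (f none - μ none) + ∑ p : Fin m × Fin l, z (some p) * f (some p)
        - ∑ p : Fin m × Fin l, z (some p) * μ (some p)) := by
    rw [add_sub_assoc, ← Finset.sum_sub_distrib, mul_add, Finset.mul_sum, Fintype.sum_option]
    congr 1
    · simp only [hy]; ring
    · exact Finset.sum_congr rfl fun p _ => by simp only [hy]; ring
  rw [e] at h1
  set D := ∑ i, (f i - μ i) ^ 2 with hD
  have hd : (f none - μ none) ^ 2 ≤ D :=
    Finset.single_le_sum (f := fun i => (f i - μ i) ^ 2) (fun i _ => sq_nonneg _)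
      (Finset.mem_univ none)
  have h2 : z none * (f none - μ none) ≤ W * |f none - μ none| := by
    refine (le_abs_self _).trans ?_
    rw [abs_mul]
    exact mul_le_mul_of_nonneg_right hz0 (abs_nonneg _)
  have h3 : W * (f none - μ none) ≤ W * |f none - μ none| :=
    mul_le_mul_of_nonneg_left (le_abs_self _) hW0
  have h4 : D ≤ σ * (2 * W * |f none - μ none| + 2 * W * μ none) :=
    h1.trans (mul_le_mul_of_nonneg_left (by linarith) hσ)
  have hW2 : W ^ 2 = l * B := by rw [hW, mul_pow, hs2, hb2]
  -- the term linear in the error at the root is absorbed into half of the loss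
  have h5 := sq_nonneg (2 * (σ * W) - |f none - μ none|)
  rw [← sq_abs] at hd
  have h6 : 4 * (σ : ℝ) ^ 2 * l * B = 4 * (σ * W) ^ 2 := by rw [mul_pow, hW2]; ring
  rw [h6]
  nlinarith

end Paths

/-! ### The risk bound -/

section Risk

variable {m l : ℕ}

/-- The risk bound on the tree with `m` paths of length `l`. -/
theorem kite_risk_le (hl : 0 < l) {μ : Option (Fin m × Fin l) → ℝ}
    (hμ : μ ∈ (kite m l).flows) (σ : ℝ≥0) {L : ℝ} (hL : 1 ≤ L)
    (hcard : (m * l + 1 : ℝ) ≤ Real.exp (2 * L)) :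
    Integrable (fun y => ∑ i, ((kite m l).lse y i - μ i) ^ 2) (obsLaw μ σ) ∧
      ∫ y, ∑ i, ((kite m l).lse y i - μ i) ^ 2 ∂(obsLaw μ σ)
        ≤ 96 * (σ ^ 2 * l * L ^ 2) + 50 * (σ * μ none * (√l * L)) := by
  have hL0 : 0 < L := by linarith
  have hμ0 := root_nonneg hl hμ
  have hσ : (0 : ℝ) ≤ σ := σ.2
  have hcont : Continuous fun y => ∑ i, ((kite m l).lse y i - μ i) ^ 2 :=
    continuous_finsetSum _ fun i _ =>
      ((((continuous_apply i).comp (kite m l).continuous_lse)).sub continuous_const).pow 2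
  have hmap : Continuous fun (z : Option (Fin m × Fin l) → ℝ) i => μ i + σ * z i := by fun_prop
  rw [obsLaw_eq_map_stdNoise, integrable_map_measure hcont.aestronglyMeasurable hmap.aemeasurable,
    integral_map hmap.aemeasurable hcont.aestronglyMeasurable]
  set B := softMaxSq (pathCoeff m l) (2 * L) with hB
  have hBint : Integrable B (stdNoise _) := integrable_softMaxSq _ _
  have hBle : ∫ z, B z ∂stdNoise _ ≤ 24 * L ^ 2 := by
    have h := integral_softMaxSq_le (c := 2 * L) (sum_sq_pathCoeff_le (m := m) (l := l))
      (by simpa using hcard)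
    nlinarith
  set p : ℝ := 4 * σ ^ 2 * l + 2 * σ * μ none * √l / L with hp
  set q : ℝ := 2 * σ * μ none * √l * L with hq
  have hp0 : 0 ≤ p := by positivity
  -- `√B` is linearized at the typical size `L` by the arithmetic-geometric mean inequality
  have hle (z : Option (Fin m × Fin l) → ℝ) :
      ∑ i, ((kite m l).lse (fun i => μ i + σ * z i) i - μ i) ^ 2 ≤ p * B z + q := by
    refine (loss_le_softMaxSq hl hμ σ (2 * L) z).trans ?_
    have hb : √(B z) ^ 2 = B z := Real.sq_sqrt (softMaxSq_nonneg _ _ _)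
    have h1 : 2 * √(B z) ≤ B z / L + L := by
      have e : B z / L + L - 2 * √(B z) = (√(B z) - L) ^ 2 / L := by
        rw [sub_sq, hb]; field_simp; ring
      rw [← sub_nonneg, e]
      positivity
    have h2 := mul_le_mul_of_nonneg_left h1 (by positivity : 0 ≤ 2 * σ * μ none * √l)
    have h3 : p * B z + q = 4 * σ ^ 2 * l * B z + 2 * σ * μ none * √l * (B z / L + L) := by
      rw [hp, hq]; ring
    rw [h3]
    linarith
  have hdom : Integrable (fun z => p * B z + q) (stdNoise _) :=
    (hBint.const_mul p).add (integrable_const q)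
  have hint : Integrable ((fun y => ∑ i, ((kite m l).lse y i - μ i) ^ 2) ∘
      fun z i => μ i + σ * z i) (stdNoise _) := by
    refine hdom.mono' (hcont.comp hmap).aestronglyMeasurable (Filter.Eventually.of_forall ?_)
    intro z
    rw [Function.comp_apply, Real.norm_of_nonneg (Finset.sum_nonneg fun i _ => sq_nonneg _)]
    exact hle z
  refine ⟨hint, (integral_mono hint hdom hle).trans ?_⟩
  rw [integral_add (hBint.const_mul p) (integrable_const q), integral_const_mul]
  simp only [integral_const, probReal_univ, one_smul]
  have h := mul_le_mul_of_nonneg_left hBle hp0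
  have e : p * (24 * L ^ 2) + q = 96 * (σ ^ 2 * l * L ^ 2) + 50 * (σ * μ none * (√l * L)) := by
    rw [hp, hq]; field_simp; ring
  linarith

theorem ceil_rpow_le {n : ℕ} (hn : 1 ≤ n) {a : ℝ} (ha : 0 ≤ a) :
    (⌈(n : ℝ) ^ a⌉₊ : ℝ) ≤ 2 * (n : ℝ) ^ a := by
  have h1 : 1 ≤ (n : ℝ) ^ a := Real.one_le_rpow (by exact_mod_cast hn) ha
  have h2 := Nat.ceil_lt_add_one (zero_le_one.trans h1)
  linarith

end Risk

end TreeFlow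

end

theorem mainTheorem5 :
    ∃ C : ℝ, 0 < C ∧
      ∀ (n : ℕ), 1 ≤ n → ∀ (α : ℝ), 0 ≤ α → α ≤ 1 → ∀ (σ : ℝ≥0) (V : ℝ),
        ∀ μ ∈ (TreeFlow.deepTree α n).flows, μ (TreeFlow.deepTree α n).root ≤ V →
          Integrable (fun y => ∑ i, ((TreeFlow.deepTree α n).lse y i - μ i) ^ 2)
            (TreeFlow.obsLaw μ σ) ∧
          ∫ y, (1 / (n : ℝ)) * ∑ i, ((TreeFlow.deepTree α n).lse y i - μ i) ^ 2
              ∂(TreeFlow.obsLaw μ σ)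
            ≤ C * ((σ : ℝ) ^ 2 * Real.log (Real.exp 1 * n) ^ 3 / (n : ℝ) ^ α
              + V * ((σ : ℝ) * Real.log (Real.exp 1 * n) ^ (3 / 2 : ℝ) / (n : ℝ) ^ α)) := by
  refine ⟨192, by norm_num, fun n hn α hα0 hα1 σ V μ hμ hV => ?_⟩
  have hnR : (1 : ℝ) ≤ n := by exact_mod_cast hn
  have hn0 : (0 : ℝ) < n := by linarith
  set L := Real.log (Real.exp 1 * n) with hL
  have hL1 : 1 ≤ L := by
    rw [hL, Real.log_mul (Real.exp_ne_zero _) hn0.ne', Real.log_exp]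
    linarith [Real.log_nonneg hnR]
  have hexpL : Real.exp (2 * L) = (Real.exp 1 * n) ^ 2 := by
    rw [mul_comm, Real.exp_mul, hL, Real.exp_log (by positivity)]
    norm_cast
  set m := TreeFlow.numPaths α n with hm
  set l := TreeFlow.pathLength α n with hl
  have hlpos : 0 < l := Nat.ceil_pos.2 (by positivity)
  have hl2 : (l : ℝ) ≤ 2 * (n : ℝ) ^ (1 - α) := TreeFlow.ceil_rpow_le hn (by linarith)
  have hm2 : (m : ℝ) ≤ 2 * (n : ℝ) ^ α := TreeFlow.ceil_rpow_le hn hα0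
  have hprod : (n : ℝ) ^ α * (n : ℝ) ^ (1 - α) = n := by
    rw [← Real.rpow_add hn0]; simp
  have hcard : (m * l + 1 : ℝ) ≤ Real.exp (2 * L) := by
    have h1 : (m * l : ℝ) ≤ (2 * (n : ℝ) ^ α) * (2 * (n : ℝ) ^ (1 - α)) :=
      mul_le_mul hm2 hl2 (by positivity) (by positivity)
    have h2 := Real.exp_one_gt_d9
    rw [hexpL]
    have h3 : (5 : ℝ) ≤ Real.exp 1 ^ 2 := by nlinarith
    have h4 : (n : ℝ) ≤ (n : ℝ) ^ 2 := by nlinarith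
    calc (m * l + 1 : ℝ) ≤ 4 * n + 1 := by linarith
      _ ≤ 5 * (n : ℝ) ^ 2 := by linarith
      _ ≤ (Real.exp 1 * n) ^ 2 := by rw [mul_pow]; gcongr
  obtain ⟨hint, hle⟩ := TreeFlow.kite_risk_le hlpos hμ σ hL1 hcard
  refine ⟨hint, ?_⟩
  rw [integral_const_mul]
  have hV' : μ none ≤ V := hV
  have hμ0 : 0 ≤ μ none := TreeFlow.root_nonneg hlpos hμ
  have hσ : (0 : ℝ) ≤ σ := σ.2
  have hlR : (1 : ℝ) ≤ l := by exact_mod_cast hlpos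
  have hsl : √(l : ℝ) ≤ l := Real.sqrt_le_self_iff.2 (Or.inr hlR)
  have hLpow : L ≤ L ^ (3 / 2 : ℝ) := Real.self_le_rpow_of_one_le hL1 (by norm_num)
  have hL23 : L ^ 2 ≤ L ^ 3 := pow_le_pow_right₀ hL1 (by norm_num)
  have hL0 : 0 ≤ L := by linarith
  have hln : 1 / (n : ℝ) * l ≤ 2 / (n : ℝ) ^ α := by
    rw [div_mul_eq_mul_div, one_mul, div_le_div_iff₀ hn0 (by positivity)]
    calc (l : ℝ) * (n : ℝ) ^ α ≤ (2 * (n : ℝ) ^ (1 - α)) * (n : ℝ) ^ α := by gcongr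
      _ = 2 * n := by rw [mul_assoc, mul_comm (_ ^ (1 - α)), hprod]
  have hV0 : 0 ≤ V := hμ0.trans hV'
  have hb1 : (σ : ℝ) ^ 2 * l * L ^ 2 ≤ l * (σ ^ 2 * L ^ 3) := by
    rw [mul_comm _ (l : ℝ), mul_assoc]; gcongr
  have hb2 : σ * μ none * (√l * L) ≤ l * (V * (σ * L ^ (3 / 2 : ℝ))) := by
    calc σ * μ none * (√l * L) ≤ σ * V * (l * L ^ (3 / 2 : ℝ)) := by gcongr
      _ = _ := by ring
  have hpos : 0 ≤ V * ((σ : ℝ) * L ^ (3 / 2 : ℝ)) := by positivity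
  have hpos1 : 0 ≤ (σ : ℝ) ^ 2 * L ^ 3 := by positivity
  set S := (σ : ℝ) ^ 2 * L ^ 3 + V * (σ * L ^ (3 / 2 : ℝ)) with hS
  have hS0 : 0 ≤ S := add_nonneg hpos1 hpos
  have htot : ∫ y, ∑ i, ((TreeFlow.deepTree α n).lse y i - μ i) ^ 2 ∂(TreeFlow.obsLaw μ σ)
      ≤ 96 * (l * S) := by
    have h1 : 0 ≤ (l : ℝ) * (V * ((σ : ℝ) * L ^ (3 / 2 : ℝ))) := by positivity
    refine hle.trans ?_
    rw [hS, mul_add]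
    linarith
  calc _ ≤ 1 / (n : ℝ) * (96 * (l * S)) := by gcongr
    _ = 96 * S * (1 / (n : ℝ) * l) := by ring
    _ ≤ 96 * S * (2 / (n : ℝ) ^ α) := by gcongr
    _ = _ := by rw [hS]; ring
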